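/- Consider the linear system $x_{k+1}=Ax_k+Bu_k+\omega_k$ with $x_k\in\mathbb R^{n_x}$, $u_k\in\mathbb R^{n_u}$, where the $\omega_k$ are independent, identically distributed and square integrable with $\mathbb E[\omega_k]=0$ and $\mathbb E[\omega_k\omega_k^T]=W$. Let $Q\succcurlyeq 0$, $R\succ 0$, with $(A,B)$ controllable and $(A,Q^{1/2})$ observable; let $C$ be a matrix, $t>0$, $\gamma\in(0,1)$, and let $x^r,u^r$ satisfy $(I-A)x^r=Bu^r$ and $\|Cx^r\|<t$. Write $\|v\|_M^2=v^TMv$. Let $K$ be a gain such that $\Phi=A+BK$ is strictly stable, let $P\succ0$ satisfy $P=\Phi^TP\Phi+K^TRK+Q$, and let $\hat X_i=\sum_{j<i}\Phi^jW(\Phi^j)^T$. Let $N\ge 1$. For a state $x$ and nominal inputs $m=(m_0,\dots,m_{N-1})$ define the nominal predictions by $\bar x_0=x$, $\bar x_{i+1}=A\bar x_i+Bm_i$ for $0\le i<N$, and $\bar x_{i+1}=\Phi(\bar x_i-x^r)+x^r$ for $i\ge N$. With real $n_x\times n_x$ matrices $\widetilde P,\widetilde S$ put $$f(z)=\tfrac{\operatorname{tr}(C^TC\widetilde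 S)}{t^2}+\tfrac{\gamma^N}{t^2}\Bigl[\|z-x^r\|_{\widetilde P}^2+\tfrac{\|x^r\|_{C^TC}^2}{1-\gamma}\Bigr]+\tfrac{2\gamma^N}{t^2}(x^r)^TC^TC(I-\gamma\Phi)^{-1}(z-x^r).$$ The MPC optimisation at $(x,\varepsilon)$ is to minimise $$\|\bar x_N-x^r\|_P^2+\sum_{i=0}^{N-1}\bigl(\|\bar x_i-x^r\|_Q^2+\|m_i-u^r\|_R^2\bigr)$$ over $m$ subject to the existence of $\beta_0,\dots,\beta_{N-1}\ge 0$ with $\bigl(\operatorname{tr}(C^TC\hat X_i)+\|C\bar x_i\|^2\bigr)/t^2\le\beta_i$ for $0\le i<N$ and $\sum_{i=0}^{N-1}\gamma^i\beta_i+f(\bar x_N)\le\varepsilon$. Let $m^*(x,\varepsilon)$ be a (measurable) choice of minimiser, defined whenever the optimisation is feasible. In closed loop, $x_0$ and $\varepsilon_0$ are given such that the optimisation is feasible at $(x_0,\varepsilon_0)$. At each time $k$, let $m^*_{\cdot|k}=m^*(x_k,\varepsilon_k)$, let $\bar x^*_{i|k}$ be the corresponding predictions from $x_k$, and apply $u_k=m^*_{0|k}$,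 so that $x_{k+1}=Ax_k+Bm^*_{0|k}+\omega_k$; then set $$\varepsilon_{k+1}=\sum_{i=0}^{N-1}\gamma^i\,\frac{\operatorname{tr}(C^TC\hat X_i)+\|C(\bar x^*_{i+1|k}+\Phi^i\omega_k)\|^2}{t^2}+f\bigl(\bar x^*_{N+1|k}+\Phi^N\omega_k\bigr).$$ Suppose that $K=K_{LQ}$ is the unconstrained LQ-optimal gain, that is, for the disturbance-free system $x_{k+1}=Ax_k+Bu_k$ and every initial state, the feedback law $u=K(x-x^r)+u^r$ minimises $\sum_{k\ge0}\|x_k-x^r\|_Q^2+\|u_k-u^r\|_R^2\in[0,\infty]$ over all input sequences. Then the MPC optimisation is feasible at every time $k$, and the MPC law converges to the unconstrained LQ-optimal feedback law: $$u_k-\bigl(K_{LQ}(x_k-x^r)+u^r\bigr)\longrightarrow 0\qquad(k\to\infty)$$ for every realisation of the disturbance, and also in mean square, $\mathbb E\bigl\|u_k-(K_{LQ}(x_k-x^r)+u^r)\bigr\|^2\to0$. -/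

import Mathlib

open scoped MatrixOrder

noncomputable section

namespace ChanceMPC

open Matrix

/-- The quadratic form `‖v‖²_M = vᵀ M v`. -/
def quadNorm {n : ℕ} (M : Matrix (Fin n) (Fin n) ℝ) (v : Fin n → ℝ) : ℝ :=
  v ⬝ᵥ (M *ᵥ v)

/-- The squared Euclidean norm `‖v‖² = vᵀ v`. -/
def sqNorm {n : ℕ} (v : Fin n → ℝ) : ℝ := v ⬝ᵥ v

/-- `(A, B)` is controllable: the columns of `B, A B, …, A ^ (n - 1) B` span the state space. -/
def IsControllable {n p : ℕ} (A : Matrix (Fin n) (Fin n) ℝ) (B : Matrix (Fin n) (Fin p) ℝ) :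
    Prop :=
  (⨆ i : Fin n, LinearMap.range (A ^ (i : ℕ) * B).mulVecLin) = ⊤

/-- `(A, H)` is observable: the kernels of `H, H A, …, H A ^ (n - 1)` intersect in `0`. -/
def IsObservable {n p : ℕ} (A : Matrix (Fin n) (Fin n) ℝ) (H : Matrix (Fin p) (Fin n) ℝ) :
    Prop :=
  (⨅ i : Fin n, LinearMap.ker (H * A ^ (i : ℕ)).mulVecLin) = ⊥

/-- Strict (discrete-time) stability: all complex eigenvalues lie in the open unit disc. -/
def IsStrictlyStable {n : ℕ} (M : Matrix (Fin n) (Fin n) ℝ) : Prop :=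
  ∀ z ∈ spectrum ℂ (M.map (fun r : ℝ => (r : ℂ))), ‖z‖ < 1

/-! ### The unconstrained LQ problem -/

/-- State trajectory of the disturbance-free system under an input sequence. -/
def openLoopState {n p : ℕ} (A : Matrix (Fin n) (Fin n) ℝ) (B : Matrix (Fin n) (Fin p) ℝ)
    (x₀ : Fin n → ℝ) (v : ℕ → Fin p → ℝ) : ℕ → Fin n → ℝ
  | 0 => x₀
  | k + 1 => A *ᵥ openLoopState A B x₀ v k + B *ᵥ v k

/-- State trajectory of the disturbance-free system under `u = K (x - xʳ) + uʳ`. -/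
def feedbackState {n p : ℕ} (A : Matrix (Fin n) (Fin n) ℝ) (B : Matrix (Fin n) (Fin p) ℝ)
    (K : Matrix (Fin p) (Fin n) ℝ) (xr : Fin n → ℝ) (ur : Fin p → ℝ) (x₀ : Fin n → ℝ) :
    ℕ → Fin n → ℝ
  | 0 => x₀
  | k + 1 => A *ᵥ feedbackState A B K xr ur x₀ k
      + B *ᵥ (K *ᵥ (feedbackState A B K xr ur x₀ k - xr) + ur)

/-- The infinite-horizon cost `∑ₖ ‖xₖ - xʳ‖²_Q + ‖uₖ - uʳ‖²_R`, a value in `[0, ∞]`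
(the summands are nonnegative for positive semidefinite `Q`, `R`). -/
def lqCost {n p : ℕ} (Q : Matrix (Fin n) (Fin n) ℝ) (R : Matrix (Fin p) (Fin p) ℝ)
    (xr : Fin n → ℝ) (ur : Fin p → ℝ) (x : ℕ → Fin n → ℝ) (u : ℕ → Fin p → ℝ) : ENNReal :=
  ∑' k : ℕ, ENNReal.ofReal (quadNorm Q (x k - xr) + quadNorm R (u k - ur))

/-- `K` is the unconstrained LQ-optimal feedback gain: from every initial state, the feedback law
`u = K (x - xʳ) + uʳ` minimises the infinite-horizon quadratic cost over all input sequences.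
The problem is posed for the disturbance-free system: with a persistent disturbance the expected
infinite-horizon cost is `∞` for every control law and selects no gain. -/
def IsLQOptimalGain {n p : ℕ} (A : Matrix (Fin n) (Fin n) ℝ) (B : Matrix (Fin n) (Fin p) ℝ)
    (Q : Matrix (Fin n) (Fin n) ℝ) (R : Matrix (Fin p) (Fin p) ℝ)
    (xr : Fin n → ℝ) (ur : Fin p → ℝ) (K : Matrix (Fin p) (Fin n) ℝ) : Prop :=
  ∀ (x₀ : Fin n → ℝ) (v : ℕ → Fin p → ℝ),
    lqCost Q R xr ur (feedbackState A B K xr ur x₀)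
        (fun k => K *ᵥ (feedbackState A B K xr ur x₀ k - xr) + ur)
      ≤ lqCost Q R xr ur (openLoopState A B x₀ v) v

/-! ### The MPC algorithm -/

/-- The data of the MPC problem: state, input and output dimensions `nx`, `nu`, `nc`, and
prediction horizon `N`. -/
structure MPCData (nx nu nc N : ℕ) where
  /-- state matrix -/
  A : Matrix (Fin nx) (Fin nx) ℝ
  /-- input matrix -/
  B : Matrix (Fin nx) (Fin nu) ℝ
  /-- constraint output matrix -/
  C : Matrix (Fin nc) (Fin nx) ℝ
  /-- state weight -/
  Q : Matrix (Fin nx) (Fin nx) ℝ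
  /-- input weight -/
  R : Matrix (Fin nu) (Fin nu) ℝ
  /-- second moment of the disturbance -/
  W : Matrix (Fin nx) (Fin nx) ℝ
  /-- feedback gain of the predicted control inputs -/
  K : Matrix (Fin nu) (Fin nx) ℝ
  /-- terminal cost weight -/
  P : Matrix (Fin nx) (Fin nx) ℝ
  /-- quadratic weight in the terminal constraint term -/
  Pt : Matrix (Fin nx) (Fin nx) ℝ
  /-- covariance weight in the terminal constraint term -/
  St : Matrix (Fin nx) (Fin nx) ℝ
  /-- state reference -/
  xr : Fin nx → ℝ
  /-- input reference -/
  ur : Fin nu → ℝ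
  /-- constraint threshold -/
  t : ℝ
  /-- discount factor -/
  γ : ℝ

namespace MPCData

variable {nx nu nc N : ℕ} (D : MPCData nx nu nc N)

/-- `Φ = A + B K`. -/
def Phi : Matrix (Fin nx) (Fin nx) ℝ := D.A + D.B * D.K

/-- Covariance of the `i`-step-ahead predicted state: `X̂ᵢ = ∑_{j < i} Φʲ W (Φʲ)ᵀ`. -/
def Xhat (i : ℕ) : Matrix (Fin nx) (Fin nx) ℝ :=
  ∑ j ∈ Finset.range i, D.Phi ^ j * D.W * (D.Phi ^ j)ᵀ

/-- Nominal predicted states from the current state `x` under the nominal inputs `m₀, …, m_{N-1}`: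
`x̄₀ = x`, `x̄_{i+1} = A x̄ᵢ + B mᵢ` for `i < N`, and `x̄_{i+1} = Φ (x̄ᵢ - xʳ) + xʳ` for `i ≥ N`. -/
def predState (x : Fin nx → ℝ) (m : Fin N → Fin nu → ℝ) : ℕ → Fin nx → ℝ
  | 0 => x
  | i + 1 =>
    if h : i < N then D.A *ᵥ predState x m i + D.B *ᵥ m ⟨i, h⟩
    else D.Phi *ᵥ (predState x m i - D.xr) + D.xr

/-- The Chebyshev bound `(tr(Cᵀ C X̂ᵢ) + ‖C z‖²) / t²` on the violation probability at
prediction step `i` when the nominal predicted state is `z`. -/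
def chebBound (i : ℕ) (z : Fin nx → ℝ) : ℝ :=
  (Matrix.trace (D.Cᵀ * D.C * D.Xhat i) + sqNorm (D.C *ᵥ z)) / D.t ^ 2

/-- The terminal constraint term `f`. -/
def termF (z : Fin nx → ℝ) : ℝ :=
  Matrix.trace (D.Cᵀ * D.C * D.St) / D.t ^ 2
    + D.γ ^ N / D.t ^ 2 *
        (quadNorm D.Pt (z - D.xr) + quadNorm (D.Cᵀ * D.C) D.xr / (1 - D.γ))
    + 2 * D.γ ^ N * (D.xr ⬝ᵥ ((D.Cᵀ * D.C * (1 - D.γ • D.Phi)⁻¹) *ᵥ (z - D.xr))) / D.t ^ 2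

/-- The constraints of the MPC optimisation: nonnegative `β₀, …, β_{N-1}` exist that bound the
Chebyshev terms and whose discounted sum plus the terminal term is at most `ε`. -/
def Feasible (x : Fin nx → ℝ) (ε : ℝ) (m : Fin N → Fin nu → ℝ) : Prop :=
  ∃ β : Fin N → ℝ, (∀ i, 0 ≤ β i) ∧
    (∀ i : Fin N, D.chebBound i (D.predState x m i) ≤ β i) ∧
    ∑ i : Fin N, D.γ ^ (i : ℕ) * β i + D.termF (D.predState x m N) ≤ ε

/-- The predicted cost (its finite value, on feasible input sequences). -/
def predCost (x : Fin nx → ℝ) (m : Fin N → Fin nu → ℝ) : ℝ :=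
  quadNorm D.P (D.predState x m N - D.xr)
    + ∑ i : Fin N, (quadNorm D.Q (D.predState x m i - D.xr) + quadNorm D.R (m i - D.ur))

/-- `m` solves the MPC optimisation at state `x` and constraint level `ε`. -/
def IsMinimiser (x : Fin nx → ℝ) (ε : ℝ) (m : Fin N → Fin nu → ℝ) : Prop :=
  D.Feasible x ε m ∧ ∀ m', D.Feasible x ε m' → D.predCost x m ≤ D.predCost x m'

/-- `mstar` is a solution map of the MPC optimisation: at every `(x, ε)` for which the optimisation
is feasible, `mstar x ε` is a minimiser. Nothing is required at infeasible `(x, ε)`. -/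
def IsSolutionMap (mstar : (Fin nx → ℝ) → ℝ → Fin N → Fin nu → ℝ) : Prop :=
  ∀ x ε, (∃ m, D.Feasible x ε m) → D.IsMinimiser x ε (mstar x ε)

/-- The constraint level at the next time step, from the current state `x`, the current optimal
sequence `m` and the disturbance realisation `w`. -/
def epsNext (x : Fin nx → ℝ) (m : Fin N → Fin nu → ℝ) (w : Fin nx → ℝ) : ℝ :=
  ∑ i : Fin N, D.γ ^ (i : ℕ) *
      D.chebBound i (D.predState x m ((i : ℕ) + 1) + D.Phi ^ (i : ℕ) *ᵥ w)
    + D.termF (D.predState x m (N + 1) + D.Phi ^ N *ᵥ w)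

/-- The closed loop `(xₖ, εₖ)` under the MPC algorithm, for a realisation `w` of the disturbance
sequence: `x_{k+1} = A xₖ + B m*_{0|k} + wₖ`, with `εₖ` updated by `epsNext`. -/
def closedLoop [NeZero N] (mstar : (Fin nx → ℝ) → ℝ → Fin N → Fin nu → ℝ)
    (x₀ : Fin nx → ℝ) (ε₀ : ℝ) (w : ℕ → Fin nx → ℝ) : ℕ → (Fin nx → ℝ) × ℝ
  | 0 => (x₀, ε₀)
  | k + 1 =>
    let x := (closedLoop mstar x₀ ε₀ w k).1
    let ε := (closedLoop mstar x₀ ε₀ w k).2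
    (D.A *ᵥ x + D.B *ᵥ mstar x ε 0 + w k, D.epsNext x (mstar x ε) (w k))

/-- The closed-loop state `xₖ`. -/
def state [NeZero N] (mstar : (Fin nx → ℝ) → ℝ → Fin N → Fin nu → ℝ)
    (x₀ : Fin nx → ℝ) (ε₀ : ℝ) (w : ℕ → Fin nx → ℝ) (k : ℕ) : Fin nx → ℝ :=
  (D.closedLoop mstar x₀ ε₀ w k).1

/-- The closed-loop constraint level `εₖ`. -/
def level [NeZero N] (mstar : (Fin nx → ℝ) → ℝ → Fin N → Fin nu → ℝ)
    (x₀ : Fin nx → ℝ) (ε₀ : ℝ) (w : ℕ → Fin nx → ℝ) (k : ℕ) : ℝ :=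
  (D.closedLoop mstar x₀ ε₀ w k).2

/-- The MPC law `uₖ = m*_{0|k}`. -/
def control [NeZero N] (mstar : (Fin nx → ℝ) → ℝ → Fin N → Fin nu → ℝ)
    (x₀ : Fin nx → ℝ) (ε₀ : ℝ) (w : ℕ → Fin nx → ℝ) (k : ℕ) : Fin nu → ℝ :=
  mstar (D.state mstar x₀ ε₀ w k) (D.level mstar x₀ ε₀ w k) 0

end MPCData

/-- The disturbance is independent and identically distributed with finite second moments,
zero mean and second moment matrix `W`. -/
structure IsDisturbance {Ω : Type*} [MeasurableSpace Ω] (μ : MeasureTheory.Measure Ω) {n : ℕ}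
    (W : Matrix (Fin n) (Fin n) ℝ) (w : ℕ → Ω → Fin n → ℝ) : Prop where
  measurable : ∀ k, Measurable (w k)
  indep : ProbabilityTheory.iIndepFun w μ
  identDistrib : ∀ k, ProbabilityTheory.IdentDistrib (w k) (w 0) μ μ
  memLp : ∀ k, MeasureTheory.MemLp (w k) 2 μ
  mean : ∀ k i, ∫ ω, w k ω i ∂μ = 0
  secondMoment : ∀ k i j, ∫ ω, w k ω i * w k ω j ∂μ = W i j

end ChanceMPC

end

/-! Write the predicted inputs as the LQ feedback law plus deviations `c_i`. Since the LQ gain is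
optimal, completing the square makes the predicted cost split as `‖x - xʳ‖²_P + ∑ ‖c_i‖²_S` with `S
= R + BᵀPB` (`stage_add_next`, `predCost_eq`): the state enters only through a term that no input
can change. The vanishing of the cross term comes from a variational argument on the
infinite-horizon cost, not from a Riccati equation.

After a disturbance `w`, shift the predicted inputs by one step and add the feedback correction `K
Φ^i w`. The predictions move by `Φ^i w`, and `ε_{k+1}` is by definition the constraint value of this
shifted sequence, so it is feasible (`feasible_shiftInput`). Its deviations are `c_1, …, c_{N-1},
0`, whatever `w` is (`inputDev_shiftInput`). By optimality the deviation cost therefore drops at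
each step by at least `‖c_0‖²_S` (`devCost_closedLoop_succ_le`), where `c_0` is the gap between the
MPC law and the LQ law.

Summing bounds `∑ ‖c_0‖²` by a constant independent of the realisation (`exists_sum_sqNorm_le`),
which gives convergence along every path and, after integration, in mean square. -/

namespace ChanceMPC

open Matrix Filter Topology

/-! ### Quadratic forms -/

section QuadraticForms

variable {n p : ℕ}

lemma quadNorm_nonneg {M : Matrix (Fin n) (Fin n) ℝ} (hM : M.PosSemidef) (v : Fin n → ℝ) :
    0 ≤ quadNorm M v := by
  simpa [quadNorm] using hM.dotProduct_mulVec_nonneg v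

lemma sqNorm_nonneg (v : Fin n → ℝ) : 0 ≤ sqNorm v := by
  unfold sqNorm dotProduct
  exact Finset.sum_nonneg fun i _ => mul_self_nonneg (v i)

lemma sqNorm_normalize {v : Fin n → ℝ} (h : 0 < sqNorm v) :
    sqNorm ((Real.sqrt (sqNorm v))⁻¹ • v) = 1 := by
  have hs : ∀ s : ℝ, sqNorm (s • v) = s ^ 2 * sqNorm v := fun s => by
    simp only [sqNorm, smul_dotProduct, dotProduct_smul, smul_eq_mul]
    ring
  rw [hs, inv_pow, Real.sq_sqrt h.le, inv_mul_cancel₀ h.ne']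

lemma quadNorm_add {M : Matrix (Fin n) (Fin n) ℝ} (hM : Mᵀ = M) (u v : Fin n → ℝ) :
    quadNorm M (u + v) = quadNorm M u + quadNorm M v + 2 * (v ⬝ᵥ (M *ᵥ u)) := by
  have h : u ⬝ᵥ (M *ᵥ v) = v ⬝ᵥ (M *ᵥ u) := by
    rw [dotProduct_mulVec, ← mulVec_transpose, hM, dotProduct_comm]
  simp only [quadNorm, mulVec_add, dotProduct_add, add_dotProduct, h]
  ring

lemma quadNorm_smul (M : Matrix (Fin n) (Fin n) ℝ) (s : ℝ) (v : Fin n → ℝ) :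
    quadNorm M (s • v) = s ^ 2 * quadNorm M v := by
  simp only [quadNorm, mulVec_smul, dotProduct_smul, smul_dotProduct, smul_eq_mul]
  ring

lemma quadNorm_conj (T : Matrix (Fin p) (Fin n) ℝ) (M : Matrix (Fin p) (Fin p) ℝ)
    (v : Fin n → ℝ) : quadNorm (Tᵀ * M * T) v = quadNorm M (T *ᵥ v) := by
  simp only [quadNorm, ← mulVec_mulVec]
  rw [dotProduct_mulVec v Tᵀ, vecMul_transpose]

lemma quadNorm_add_left (M M' : Matrix (Fin n) (Fin n) ℝ) (v : Fin n → ℝ) :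
    quadNorm (M + M') v = quadNorm M v + quadNorm M' v := by
  simp [quadNorm, add_mulVec, dotProduct_add]

lemma continuous_quadNorm (M : Matrix (Fin n) (Fin n) ℝ) : Continuous (quadNorm M) := by
  unfold quadNorm
  fun_prop

/-- A positive definite quadratic form dominates a positive multiple of the squared norm. -/
lemma exists_sqNorm_le_mul_quadNorm {M : Matrix (Fin n) (Fin n) ℝ} (hM : M.PosDef) :
    ∃ c : ℝ, 0 ≤ c ∧ ∀ v, sqNorm v ≤ c * quadNorm M v := by
  have hsph : IsCompact {v : Fin n → ℝ | sqNorm v = 1} := by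
    refine Metric.isCompact_of_isClosed_isBounded ?_ ?_
    · exact isClosed_eq (by unfold sqNorm; fun_prop) continuous_const
    · refine (Metric.isBounded_closedBall (x := (0 : Fin n → ℝ)) (r := 1)).subset fun v hv => ?_
      rw [mem_closedBall_zero_iff, pi_norm_le_iff_of_nonneg zero_le_one]
      intro i
      have h : v i * v i ≤ sqNorm v :=
        Finset.single_le_sum (f := fun i => v i * v i) (fun i _ => mul_self_nonneg (v i))
          (Finset.mem_univ i)
      rw [show sqNorm v = 1 from hv] at h
      rw [Real.norm_eq_abs]
      exact abs_le_one_iff_mul_self_le_one.mpr h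
  have hpos : ∀ v : Fin n → ℝ, v ≠ 0 → 0 < quadNorm M v := fun v hv => by
    simpa [quadNorm] using hM.dotProduct_mulVec_pos hv
  -- The unit sphere is empty exactly in dimension `0`. Otherwise the constant is the reciprocal of
  -- the minimum of the form on the sphere.
  obtain hemp | hne := Set.eq_empty_or_nonempty {v : Fin n → ℝ | sqNorm v = 1}
  · refine ⟨0, le_rfl, fun v => ?_⟩
    by_contra! h
    rw [zero_mul] at h
    have : (Real.sqrt (sqNorm v))⁻¹ • v ∈ {v : Fin n → ℝ | sqNorm v = 1} :=
      sqNorm_normalize h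
    simp [hemp] at this
  · obtain ⟨z, hz, hmin⟩ := hsph.exists_isMinOn hne (continuous_quadNorm M).continuousOn
    have hz0 : z ≠ 0 := by
      rintro rfl
      simp [sqNorm] at hz
    have hq := hpos z hz0
    refine ⟨(quadNorm M z)⁻¹, (inv_pos.mpr hq).le, fun v => ?_⟩
    by_cases hv : sqNorm v = 0
    · rw [hv]
      exact mul_nonneg (inv_pos.mpr hq).le (quadNorm_nonneg hM.posSemidef v)
    have h : 0 < sqNorm v := lt_of_le_of_ne (sqNorm_nonneg v) (Ne.symm hv)
    have hmem : (Real.sqrt (sqNorm v))⁻¹ • v ∈ {v : Fin n → ℝ | sqNorm v = 1} :=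
      sqNorm_normalize h
    have hle : quadNorm M z ≤ quadNorm M ((Real.sqrt (sqNorm v))⁻¹ • v) := hmin hmem
    rw [quadNorm_smul, inv_pow, Real.sq_sqrt h.le, inv_mul_eq_div, le_div_iff₀ h] at hle
    rw [inv_mul_eq_div, le_div_iff₀ hq, mul_comm]
    exact hle

end QuadraticForms

/-! ### Powers of stable matrices -/

section Stability

attribute [local instance] Matrix.linftyOpNormedRing Matrix.linftyOpNormedAlgebra

/-- The powers of a strictly stable matrix tend to zero. -/
lemma IsStrictlyStable.tendsto_pow {n : ℕ} {M : Matrix (Fin n) (Fin n) ℝ}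
    (h : IsStrictlyStable M) : Tendsto (fun k : ℕ => M ^ k) atTop (𝓝 0) := by
  obtain hn | hn := isEmpty_or_nonempty (Fin n)
  · have : (fun k : ℕ => M ^ k) = fun _ => 0 := funext fun k => Subsingleton.elim _ _
    rw [this]
    exact tendsto_const_nhds
  -- Gelfand's formula is applied over `ℂ`, where it turns the eigenvalue bound into geometric decay
  -- of the powers; real parts then return to `M`.
  set Z : Matrix (Fin n) (Fin n) ℂ := M.map (fun r : ℝ => (r : ℂ)) with hZ
  have hZpow : ∀ k : ℕ, Z ^ k = (M ^ k).map (fun r : ℝ => (r : ℂ)) := fun k =>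
    (map_pow (Complex.ofRealHom.mapMatrix (m := Fin n)) M k).symm
  have hrad : spectralRadius ℂ Z < 1 := by
    obtain ⟨z, hz, hzr⟩ := spectrum.exists_nnnorm_eq_spectralRadius Z
    rw [← hzr]
    exact_mod_cast h z hz
  have htend : Tendsto (fun k : ℕ => Z ^ k) atTop (𝓝 0) := by
    obtain ⟨r, hr0, hr1⟩ := exists_between hrad
    lift r to NNReal using (hr1.trans ENNReal.one_lt_top).ne
    have hev := (spectrum.pow_nnnorm_pow_one_div_tendsto_nhds_spectralRadius Z).eventually
      (gt_mem_nhds hr0)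
    have hr1' : r < 1 := by exact_mod_cast hr1
    refine squeeze_zero_norm' ?_ (tendsto_pow_atTop_nhds_zero_of_lt_one r.coe_nonneg hr1')
    filter_upwards [hev, eventually_gt_atTop 0] with k hk hk0
    have h1 : (‖Z ^ k‖₊ : ENNReal) ≤ (r : ENNReal) ^ k := by
      have := ENNReal.rpow_le_rpow hk.le (Nat.cast_nonneg (α := ℝ) k)
      rwa [← ENNReal.rpow_mul, one_div, inv_mul_cancel₀ (by positivity), ENNReal.rpow_one,
        ENNReal.rpow_natCast] at this
    exact_mod_cast h1
  have hre : Continuous fun X : Matrix (Fin n) (Fin n) ℂ => X.map Complex.re :=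
    continuous_id.matrix_map Complex.continuous_re
  have := (hre.tendsto 0).comp htend
  have h0 : (0 : Matrix (Fin n) (Fin n) ℂ).map Complex.re = 0 := by ext; simp
  rw [h0] at this
  refine this.congr fun k => ?_
  ext i j
  simp [hZpow]

end Stability

/-! ### Positivity of the disturbance second moment -/

/-- The form is the second moment of the scalar `v ⬝ᵥ w 0`. -/
lemma IsDisturbance.quadNorm_nonneg {Ω : Type*} [MeasurableSpace Ω]
    {μ : MeasureTheory.Measure Ω} {n : ℕ} {W : Matrix (Fin n) (Fin n) ℝ}
    {w : ℕ → Ω → Fin n → ℝ} (hw : IsDisturbance μ W w) (v : Fin n → ℝ) : 0 ≤ quadNorm W v := by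
  have hcoord : ∀ i, MeasureTheory.MemLp (fun ω => w 0 ω i) 2 μ := fun i =>
    (MeasureTheory.memLp_pi_iff.mp (hw.memLp 0)) i
  have hint : ∀ i j, MeasureTheory.Integrable (fun ω => w 0 ω i * w 0 ω j) μ := fun i j =>
    (hcoord i).integrable_mul (hcoord j)
  have : quadNorm W v = ∫ ω, (v ⬝ᵥ w 0 ω) ^ 2 ∂μ := by
    have hexp : ∀ ω, (v ⬝ᵥ w 0 ω) ^ 2 = ∑ i, ∑ j, v i * v j * (w 0 ω i * w 0 ω j) := by
      intro ω
      rw [sq, dotProduct, Finset.sum_mul_sum]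
      exact Finset.sum_congr rfl fun i _ => Finset.sum_congr rfl fun j _ => by ring
    simp_rw [hexp]
    rw [MeasureTheory.integral_finsetSum _ fun i _ =>
      MeasureTheory.integrable_finsetSum _ fun j _ => (hint i j).const_mul _]
    simp_rw [MeasureTheory.integral_finsetSum _ fun j _ => (hint _ j).const_mul _,
      MeasureTheory.integral_const_mul, hw.secondMoment, quadNorm, dotProduct, mulVec, dotProduct,
      Finset.mul_sum]
    exact Finset.sum_congr rfl fun i _ => Finset.sum_congr rfl fun j _ => by ring
  rw [this]
  exact MeasureTheory.integral_nonneg fun ω => sq_nonneg _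

lemma IsDisturbance.posSemidef {Ω : Type*} [MeasurableSpace Ω]
    {μ : MeasureTheory.Measure Ω} {n : ℕ} {W : Matrix (Fin n) (Fin n) ℝ}
    {w : ℕ → Ω → Fin n → ℝ} (hw : IsDisturbance μ W w) : W.PosSemidef := by
  refine PosSemidef.of_dotProduct_mulVec_nonneg ?_ fun v => by
    simpa [quadNorm] using hw.quadNorm_nonneg v
  ext i j
  simp only [conjTranspose_apply, star_trivial]
  rw [← hw.secondMoment 0, ← hw.secondMoment 0]
  simp_rw [mul_comm]

namespace MPCData

variable {nx nu nc N : ℕ} (D : MPCData nx nu nc N)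

/-- By cyclicity, each trace term is the trace of `(CΦ^j) W (CΦ^j)ᵀ`, which is positive
semidefinite. This makes the Chebyshev terms themselves admissible as the `β`. -/
lemma chebBound_nonneg (hW : D.W.PosSemidef) (i : ℕ) (z : Fin nx → ℝ) :
    0 ≤ D.chebBound i z := by
  refine div_nonneg (add_nonneg ?_ (sqNorm_nonneg _)) (sq_nonneg _)
  rw [Xhat, Finset.mul_sum, trace_sum]
  refine Finset.sum_nonneg fun j _ => ?_
  have h := (hW.mul_mul_conjTranspose_same (D.C * D.Phi ^ j)).trace_nonneg
  rw [conjTranspose_eq_transpose_of_trivial, transpose_mul] at h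
  convert h using 1
  rw [Matrix.mul_assoc D.Cᵀ, trace_mul_comm]
  simp only [Matrix.mul_assoc]

/-! ### Error dynamics and the LQ-optimal cost -/

/-- One step of the error dynamics under the feedback law with perturbation `c`. -/
lemma step_sub_xr (href : (1 - D.A) *ᵥ D.xr = D.B *ᵥ D.ur) (x : Fin nx → ℝ)
    (c : Fin nu → ℝ) :
    D.A *ᵥ x + D.B *ᵥ (D.K *ᵥ (x - D.xr) + D.ur + c) - D.xr
      = D.Phi *ᵥ (x - D.xr) + D.B *ᵥ c := by
  rw [sub_mulVec, one_mulVec] at href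
  rw [mulVec_add, mulVec_add, ← href, Phi, add_mulVec, mulVec_mulVec, mulVec_sub D.A]
  abel

lemma feedbackState_sub (href : (1 - D.A) *ᵥ D.xr = D.B *ᵥ D.ur) (x : Fin nx → ℝ) (k : ℕ) :
    feedbackState D.A D.B D.K D.xr D.ur x k - D.xr = D.Phi ^ k *ᵥ (x - D.xr) := by
  induction k with
  | zero => simp [feedbackState]
  | succ k ih =>
    have h := D.step_sub_xr href (feedbackState D.A D.B D.K D.xr D.ur x k) 0
    rw [add_zero, mulVec_zero, add_zero] at h
    rw [feedbackState, h, ih, pow_succ', mulVec_mulVec]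

lemma quadNorm_P_eq (hLyap : D.P = D.Phiᵀ * D.P * D.Phi + D.Kᵀ * D.R * D.K + D.Q)
    (y : Fin nx → ℝ) :
    quadNorm D.P y
      = quadNorm D.P (D.Phi *ᵥ y) + quadNorm D.R (D.K *ᵥ y) + quadNorm D.Q y := by
  conv_lhs => rw [hLyap]
  rw [quadNorm_add_left, quadNorm_add_left, quadNorm_conj, quadNorm_conj]

/-- The infinite-horizon cost of the feedback law is `‖x - xʳ‖²_P`. -/
lemma lqCost_feedback (hQ : D.Q.PosSemidef) (hR : D.R.PosSemidef)
    (href : (1 - D.A) *ᵥ D.xr = D.B *ᵥ D.ur) (hstable : IsStrictlyStable D.Phi)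
    (hLyap : D.P = D.Phiᵀ * D.P * D.Phi + D.Kᵀ * D.R * D.K + D.Q) (x : Fin nx → ℝ) :
    lqCost D.Q D.R D.xr D.ur (feedbackState D.A D.B D.K D.xr D.ur x)
        (fun k => D.K *ᵥ (feedbackState D.A D.B D.K D.xr D.ur x k - D.xr) + D.ur)
      = ENNReal.ofReal (quadNorm D.P (x - D.xr)) := by
  have hnn : ∀ k : ℕ, 0 ≤ quadNorm D.Q (D.Phi ^ k *ᵥ (x - D.xr))
      + quadNorm D.R (D.K *ᵥ (D.Phi ^ k *ᵥ (x - D.xr))) := fun k =>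
    add_nonneg (quadNorm_nonneg hQ _) (quadNorm_nonneg hR _)
  have hsum : HasSum (fun k : ℕ => quadNorm D.Q (D.Phi ^ k *ᵥ (x - D.xr))
      + quadNorm D.R (D.K *ᵥ (D.Phi ^ k *ᵥ (x - D.xr)))) (quadNorm D.P (x - D.xr)) := by
    rw [hasSum_iff_tendsto_nat_of_nonneg hnn]
    -- The Lyapunov equation makes the stage costs telescope; stability kills the remainder.
    have hpart : ∀ m : ℕ, quadNorm D.P (x - D.xr) - quadNorm D.P (D.Phi ^ m *ᵥ (x - D.xr))
        = ∑ k ∈ Finset.range m, (quadNorm D.Q (D.Phi ^ k *ᵥ (x - D.xr))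
          + quadNorm D.R (D.K *ᵥ (D.Phi ^ k *ᵥ (x - D.xr)))) := by
      intro m
      induction m with
      | zero => simp
      | succ m ih =>
        have h := D.quadNorm_P_eq hLyap (D.Phi ^ m *ᵥ (x - D.xr))
        rw [Finset.sum_range_succ, ← ih, pow_succ', ← mulVec_mulVec]
        linarith
    have hcont : Continuous fun X : Matrix (Fin nx) (Fin nx) ℝ =>
        quadNorm D.P (X *ᵥ (x - D.xr)) :=
      (continuous_quadNorm D.P).comp (continuous_id.matrix_mulVec continuous_const)
    have hlim := (hcont.tendsto 0).comp hstable.tendsto_pow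
    have hlim' := hlim.const_sub (quadNorm D.P (x - D.xr))
    simp only [zero_mulVec, quadNorm, dotProduct_zero, mulVec_zero, sub_zero] at hlim'
    exact hlim'.congr hpart
  simp only [lqCost, add_sub_cancel_right, D.feedbackState_sub href]
  rw [← hsum.tsum_eq, ENNReal.ofReal_tsum_of_nonneg hnn hsum.summable]

/-- Perturbing the first input of the feedback law leads to the feedback trajectory from the
perturbed successor state. -/
lemma exists_input_openLoopState (href : (1 - D.A) *ᵥ D.xr = D.B *ᵥ D.ur) (y : Fin nx → ℝ)
    (c : Fin nu → ℝ) :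
    ∃ v : ℕ → Fin nu → ℝ, v 0 = D.K *ᵥ y + c + D.ur ∧
      ∀ k, openLoopState D.A D.B (y + D.xr) v (k + 1)
          = feedbackState D.A D.B D.K D.xr D.ur (D.Phi *ᵥ y + D.B *ᵥ c + D.xr) k ∧
        v (k + 1) = D.K *ᵥ (feedbackState D.A D.B D.K D.xr D.ur
          (D.Phi *ᵥ y + D.B *ᵥ c + D.xr) k - D.xr) + D.ur := by
  obtain ⟨v, hv0, hvs⟩ : ∃ v : ℕ → Fin nu → ℝ, v 0 = D.K *ᵥ y + c + D.ur ∧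
      ∀ k, v (k + 1) = D.K *ᵥ (feedbackState D.A D.B D.K D.xr D.ur
        (D.Phi *ᵥ y + D.B *ᵥ c + D.xr) k - D.xr) + D.ur :=
    ⟨fun k => Nat.casesOn k (D.K *ᵥ y + c + D.ur)
      (fun k => D.K *ᵥ (feedbackState D.A D.B D.K D.xr D.ur
        (D.Phi *ᵥ y + D.B *ᵥ c + D.xr) k - D.xr) + D.ur), rfl, fun _ => rfl⟩
  refine ⟨v, hv0, fun k => ⟨?_, hvs k⟩⟩
  induction k with
  | zero =>
    have h := D.step_sub_xr href (y + D.xr) c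
    rw [add_sub_cancel_right, add_right_comm] at h
    rw [openLoopState, openLoopState, feedbackState, hv0, ← h, sub_add_cancel]
  | succ k ih => rw [openLoopState, ih, feedbackState, hvs]

/-- Minimality of the LQ-optimal feedback law among its one-step perturbations. -/
lemma quadNorm_P_le (hQ : D.Q.PosSemidef) (hR : D.R.PosSemidef) (hP : D.P.PosSemidef)
    (href : (1 - D.A) *ᵥ D.xr = D.B *ᵥ D.ur) (hstable : IsStrictlyStable D.Phi)
    (hLyap : D.P = D.Phiᵀ * D.P * D.Phi + D.Kᵀ * D.R * D.K + D.Q)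
    (hK : IsLQOptimalGain D.A D.B D.Q D.R D.xr D.ur D.K) (y : Fin nx → ℝ) (c : Fin nu → ℝ) :
    quadNorm D.P y ≤ quadNorm D.Q y + quadNorm D.R (D.K *ᵥ y + c)
      + quadNorm D.P (D.Phi *ᵥ y + D.B *ᵥ c) := by
  obtain ⟨v, hv0, hv⟩ := D.exists_input_openLoopState href y c
  have hnn : 0 ≤ quadNorm D.Q y + quadNorm D.R (D.K *ᵥ y + c) :=
    add_nonneg (quadNorm_nonneg hQ _) (quadNorm_nonneg hR _)
  have hcost : lqCost D.Q D.R D.xr D.ur (openLoopState D.A D.B (y + D.xr) v) v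
      = ENNReal.ofReal (quadNorm D.Q y + quadNorm D.R (D.K *ᵥ y + c)
        + quadNorm D.P (D.Phi *ᵥ y + D.B *ᵥ c)) := by
    have htail := D.lqCost_feedback hQ hR href hstable hLyap (D.Phi *ᵥ y + D.B *ᵥ c + D.xr)
    rw [lqCost, add_sub_cancel_right] at htail
    rw [ENNReal.ofReal_add hnn (quadNorm_nonneg hP _), ← htail, lqCost,
      tsum_eq_zero_add' ENNReal.summable, openLoopState, hv0, add_sub_cancel_right,
      add_sub_cancel_right]
    congr 1
    exact tsum_congr fun k => by rw [(hv k).1, (hv k).2]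
  have h := hK (y + D.xr) v
  rw [D.lqCost_feedback hQ hR href hstable hLyap, add_sub_cancel_right, hcost] at h
  exact (ENNReal.ofReal_le_ofReal_iff (add_nonneg hnn (quadNorm_nonneg hP _))).mp h

/-- The weight `R + Bᵀ P B` of the perturbations of the optimal feedback law. -/
def pertWeight : Matrix (Fin nu) (Fin nu) ℝ := D.R + D.Bᵀ * D.P * D.B

lemma pertWeight_posDef (hR : D.R.PosDef) (hP : D.P.PosSemidef) : D.pertWeight.PosDef := by
  have h := hP.conjTranspose_mul_mul_same D.B
  rw [conjTranspose_eq_transpose_of_trivial] at h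
  exact hR.add_posSemidef h

lemma perturbed_cost (hR : D.R.PosSemidef) (hP : D.P.PosSemidef)
    (hLyap : D.P = D.Phiᵀ * D.P * D.Phi + D.Kᵀ * D.R * D.K + D.Q)
    (y : Fin nx → ℝ) (c : Fin nu → ℝ) :
    quadNorm D.Q y + quadNorm D.R (D.K *ᵥ y + c) + quadNorm D.P (D.Phi *ᵥ y + D.B *ᵥ c)
      = quadNorm D.P y + quadNorm D.pertWeight c
        + 2 * (c ⬝ᵥ (D.R *ᵥ (D.K *ᵥ y)) + (D.B *ᵥ c) ⬝ᵥ (D.P *ᵥ (D.Phi *ᵥ y))) := by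
  have hRs : D.Rᵀ = D.R := by
    rw [← conjTranspose_eq_transpose_of_trivial]; exact hR.isHermitian
  have hPs : D.Pᵀ = D.P := by
    rw [← conjTranspose_eq_transpose_of_trivial]; exact hP.isHermitian
  rw [quadNorm_add hRs, quadNorm_add hPs, D.quadNorm_P_eq hLyap y, pertWeight, quadNorm_add_left,
    quadNorm_conj]
  ring

/-- Completion of squares: under the LQ-optimal gain the cross term vanishes. -/
lemma stage_add_next (hQ : D.Q.PosSemidef) (hR : D.R.PosSemidef) (hP : D.P.PosSemidef)
    (href : (1 - D.A) *ᵥ D.xr = D.B *ᵥ D.ur) (hstable : IsStrictlyStable D.Phi)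
    (hLyap : D.P = D.Phiᵀ * D.P * D.Phi + D.Kᵀ * D.R * D.K + D.Q)
    (hK : IsLQOptimalGain D.A D.B D.Q D.R D.xr D.ur D.K) (y : Fin nx → ℝ) (c : Fin nu → ℝ) :
    quadNorm D.Q y + quadNorm D.R (D.K *ᵥ y + c) + quadNorm D.P (D.Phi *ᵥ y + D.B *ᵥ c)
      = quadNorm D.P y + quadNorm D.pertWeight c := by
  rw [D.perturbed_cost hR hP hLyap]
  set g := c ⬝ᵥ (D.R *ᵥ (D.K *ᵥ y)) + (D.B *ᵥ c) ⬝ᵥ (D.P *ᵥ (D.Phi *ᵥ y)) with hg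
  -- Scaling the perturbation by `s` gives a nonnegative quadratic in `s` with zero constant term,
  -- so its discriminant `(2g)²` is at most zero.
  have key : ∀ s : ℝ, 0 ≤ quadNorm D.pertWeight c * (s * s) + 2 * g * s + 0 := by
    intro s
    have h := D.quadNorm_P_le hQ hR hP href hstable hLyap hK y (s • c)
    rw [D.perturbed_cost hR hP hLyap, quadNorm_smul, mulVec_smul, smul_dotProduct,
      smul_dotProduct, smul_eq_mul, smul_eq_mul, ← mul_add, ← hg] at h
    linarith
  have hd := discrim_le_zero key
  rw [discrim] at hd
  have hg0 : g = 0 := by nlinarith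
  rw [hg0]
  ring

/-! ### Input deviations and the shifted sequence -/

/-- The predicted inputs, extended beyond the horizon by the feedback law. -/
def extInput (x : Fin nx → ℝ) (m : Fin N → Fin nu → ℝ) (i : ℕ) : Fin nu → ℝ :=
  if h : i < N then m ⟨i, h⟩ else D.K *ᵥ (D.predState x m i - D.xr) + D.ur

/-- The deviation of the predicted inputs from the feedback law. -/
def inputDev (x : Fin nx → ℝ) (m : Fin N → Fin nu → ℝ) (i : ℕ) : Fin nu → ℝ :=
  D.extInput x m i - (D.K *ᵥ (D.predState x m i - D.xr) + D.ur)

lemma inputDev_of_le (x : Fin nx → ℝ) (m : Fin N → Fin nu → ℝ) {i : ℕ} (h : N ≤ i) :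
    D.inputDev x m i = 0 := by
  rw [inputDev, extInput, dif_neg h.not_gt, sub_self]

lemma predState_succ (href : (1 - D.A) *ᵥ D.xr = D.B *ᵥ D.ur) (x : Fin nx → ℝ)
    (m : Fin N → Fin nu → ℝ) (i : ℕ) :
    D.predState x m (i + 1) = D.A *ᵥ D.predState x m i + D.B *ᵥ D.extInput x m i := by
  rw [predState, extInput]
  split_ifs with h
  · rfl
  · have h := D.step_sub_xr href (D.predState x m i) 0
    rw [add_zero, mulVec_zero, add_zero] at h
    rw [← h, sub_add_cancel]

lemma predState_succ_sub (href : (1 - D.A) *ᵥ D.xr = D.B *ᵥ D.ur) (x : Fin nx → ℝ)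
    (m : Fin N → Fin nu → ℝ) (i : ℕ) :
    D.predState x m (i + 1) - D.xr
      = D.Phi *ᵥ (D.predState x m i - D.xr) + D.B *ᵥ D.inputDev x m i := by
  rw [← D.step_sub_xr href, predState_succ D href, inputDev, add_sub_cancel]

/-- The shifted input sequence, feasible at the next time step. -/
def shiftInput (x : Fin nx → ℝ) (m : Fin N → Fin nu → ℝ) (w : Fin nx → ℝ) :
    Fin N → Fin nu → ℝ :=
  fun i => D.extInput x m (i + 1) + D.K *ᵥ (D.Phi ^ (i : ℕ) *ᵥ w)

/-- The added input `K Φ^i w` makes the disturbance propagate through `Φ` instead of `A`. The last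
shifted input is the feedback law at step `N`, so the identity reaches `i = N`. -/
lemma predState_shiftInput (href : (1 - D.A) *ᵥ D.xr = D.B *ᵥ D.ur) (x : Fin nx → ℝ)
    (m : Fin N → Fin nu → ℝ) (w : Fin nx → ℝ) {i : ℕ} (hi : i ≤ N) :
    D.predState (D.predState x m 1 + w) (D.shiftInput x m w) i
      = D.predState x m (i + 1) + D.Phi ^ i *ᵥ w := by
  induction i with
  | zero => simp [predState]
  | succ i ih =>
    rw [predState, dif_pos (Nat.lt_of_succ_le hi), ih (Nat.le_of_succ_le hi),
      D.predState_succ href x m (i + 1), pow_succ', shiftInput, ← mulVec_mulVec]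
    rw [show D.Phi *ᵥ (D.Phi ^ i *ᵥ w) = D.A *ᵥ (D.Phi ^ i *ᵥ w)
      + D.B *ᵥ (D.K *ᵥ (D.Phi ^ i *ᵥ w)) by
        conv_lhs => rw [Phi, add_mulVec, ← mulVec_mulVec, ← Phi], mulVec_add, mulVec_add]
    abel

/-- The feedback law responds to the displacement `Φ^i w` with exactly the correction `K Φ^i w`, so
`w` cancels. -/
lemma inputDev_shiftInput (href : (1 - D.A) *ᵥ D.xr = D.B *ᵥ D.ur) (x : Fin nx → ℝ)
    (m : Fin N → Fin nu → ℝ) (w : Fin nx → ℝ) {i : ℕ} (hi : i < N) :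
    D.inputDev (D.predState x m 1 + w) (D.shiftInput x m w) i = D.inputDev x m (i + 1) := by
  rw [inputDev, D.predState_shiftInput href x m w hi.le, extInput, dif_pos hi, inputDev,
    shiftInput, add_sub_right_comm (D.predState x m (i + 1)), mulVec_add]
  abel

lemma feasible_shiftInput (hW : D.W.PosSemidef) (href : (1 - D.A) *ᵥ D.xr = D.B *ᵥ D.ur)
    (x : Fin nx → ℝ) (m : Fin N → Fin nu → ℝ) (w : Fin nx → ℝ) :
    D.Feasible (D.predState x m 1 + w) (D.epsNext x m w) (D.shiftInput x m w) := by
  refine ⟨fun i => D.chebBound i (D.predState x m ((i : ℕ) + 1) + D.Phi ^ (i : ℕ) *ᵥ w),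
    fun i => D.chebBound_nonneg hW _ _, fun i => ?_, ?_⟩
  · rw [D.predState_shiftInput href x m w i.is_lt.le]
  · rw [D.predState_shiftInput href x m w le_rfl, epsNext]

/-- The total weight of the perturbations of the feedback law in a predicted input sequence. -/
def devCost (x : Fin nx → ℝ) (m : Fin N → Fin nu → ℝ) : ℝ :=
  ∑ i ∈ Finset.range N, quadNorm D.pertWeight (D.inputDev x m i)

/-- Telescoping of `stage_add_next` along the prediction, with the terminal weight `P` closing the
sum. -/
lemma predCost_eq (hQ : D.Q.PosSemidef) (hR : D.R.PosSemidef) (hP : D.P.PosSemidef)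
    (href : (1 - D.A) *ᵥ D.xr = D.B *ᵥ D.ur) (hstable : IsStrictlyStable D.Phi)
    (hLyap : D.P = D.Phiᵀ * D.P * D.Phi + D.Kᵀ * D.R * D.K + D.Q)
    (hK : IsLQOptimalGain D.A D.B D.Q D.R D.xr D.ur D.K) (x : Fin nx → ℝ)
    (m : Fin N → Fin nu → ℝ) :
    D.predCost x m = quadNorm D.P (x - D.xr) + D.devCost x m := by
  have key : ∀ l : ℕ, quadNorm D.P (D.predState x m l - D.xr)
      + ∑ i ∈ Finset.range l, (quadNorm D.Q (D.predState x m i - D.xr)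
        + quadNorm D.R (D.extInput x m i - D.ur))
      = quadNorm D.P (x - D.xr)
        + ∑ i ∈ Finset.range l, quadNorm D.pertWeight (D.inputDev x m i) := by
    intro l
    induction l with
    | zero => simp [predState]
    | succ l ih =>
      have h := D.stage_add_next hQ hR hP href hstable hLyap hK (D.predState x m l - D.xr)
        (D.inputDev x m l)
      have hu : D.K *ᵥ (D.predState x m l - D.xr) + D.inputDev x m l
          = D.extInput x m l - D.ur := by
        rw [inputDev]; abel
      rw [hu, ← D.predState_succ_sub href] at h
      rw [Finset.sum_range_succ, Finset.sum_range_succ]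
      linarith
  rw [devCost, ← key N, predCost, Finset.sum_range]
  congr 1
  refine Finset.sum_congr rfl fun i _ => ?_
  rw [extInput, dif_pos i.is_lt]

lemma devCost_nonneg (hS : D.pertWeight.PosSemidef) (x : Fin nx → ℝ)
    (m : Fin N → Fin nu → ℝ) : 0 ≤ D.devCost x m :=
  Finset.sum_nonneg fun _ _ => quadNorm_nonneg hS _

/-! ### Closed-loop feasibility and descent -/

section ClosedLoop

variable [NeZero N] {mstar : (Fin nx → ℝ) → ℝ → Fin N → Fin nu → ℝ} {x₀ : Fin nx → ℝ} {ε₀ : ℝ}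

lemma state_succ (w : ℕ → Fin nx → ℝ) (k : ℕ) :
    D.state mstar x₀ ε₀ w (k + 1)
      = D.predState (D.state mstar x₀ ε₀ w k)
          (mstar (D.state mstar x₀ ε₀ w k) (D.level mstar x₀ ε₀ w k)) 1 + w k := by
  rw [predState, dif_pos (NeZero.pos N)]
  rfl

lemma level_succ (w : ℕ → Fin nx → ℝ) (k : ℕ) :
    D.level mstar x₀ ε₀ w (k + 1)
      = D.epsNext (D.state mstar x₀ ε₀ w k)
          (mstar (D.state mstar x₀ ε₀ w k) (D.level mstar x₀ ε₀ w k)) (w k) := rfl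

lemma feasible_closedLoop (hW : D.W.PosSemidef) (href : (1 - D.A) *ᵥ D.xr = D.B *ᵥ D.ur)
    (hinit : ∃ m, D.Feasible x₀ ε₀ m) (w : ℕ → Fin nx → ℝ) (k : ℕ) :
    ∃ m, D.Feasible (D.state mstar x₀ ε₀ w k) (D.level mstar x₀ ε₀ w k) m := by
  -- No induction is needed: the shift of any input sequence meets the level computed from that
  -- sequence, feasible or not.
  cases k with
  | zero => exact hinit
  | succ k => exact ⟨_, D.state_succ w k ▸ D.level_succ w k ▸ D.feasible_shiftInput hW href _ _ _⟩

/-- The optimal perturbation cost decreases by at least the weight of the applied perturbation. -/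
lemma devCost_closedLoop_succ_le (hW : D.W.PosSemidef)
    (hQ : D.Q.PosSemidef) (hR : D.R.PosSemidef) (hP : D.P.PosSemidef)
    (href : (1 - D.A) *ᵥ D.xr = D.B *ᵥ D.ur) (hstable : IsStrictlyStable D.Phi)
    (hLyap : D.P = D.Phiᵀ * D.P * D.Phi + D.Kᵀ * D.R * D.K + D.Q)
    (hK : IsLQOptimalGain D.A D.B D.Q D.R D.xr D.ur D.K) (hmstar : D.IsSolutionMap mstar)
    (w : ℕ → Fin nx → ℝ) (k : ℕ) :
    D.devCost (D.state mstar x₀ ε₀ w (k + 1))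
        (mstar (D.state mstar x₀ ε₀ w (k + 1)) (D.level mstar x₀ ε₀ w (k + 1)))
      + quadNorm D.pertWeight (D.control mstar x₀ ε₀ w k
          - (D.K *ᵥ (D.state mstar x₀ ε₀ w k - D.xr) + D.ur))
      ≤ D.devCost (D.state mstar x₀ ε₀ w k)
        (mstar (D.state mstar x₀ ε₀ w k) (D.level mstar x₀ ε₀ w k)) := by
  set x := D.state mstar x₀ ε₀ w k with hx
  set m := mstar x (D.level mstar x₀ ε₀ w k) with hm
  have hfeas := D.feasible_shiftInput hW href x m (w k)
  rw [hm, hx, ← D.state_succ, ← D.level_succ, ← hx, ← hm] at hfeas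
  have hle := (hmstar _ _ ⟨_, hfeas⟩).2 _ hfeas
  -- Both costs start from the same disturbed state, so their `P`-terms cancel and only deviation
  -- costs remain.
  simp only [D.predCost_eq hQ hR hP href hstable hLyap hK, add_le_add_iff_left] at hle
  have hshift : D.devCost (D.state mstar x₀ ε₀ w (k + 1)) (D.shiftInput x m (w k))
      = ∑ i ∈ Finset.range N, quadNorm D.pertWeight (D.inputDev x m (i + 1)) := by
    rw [D.state_succ]
    exact Finset.sum_congr rfl fun i hi => by
      rw [← D.inputDev_shiftInput href x m (w k) (Finset.mem_range.mp hi)]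
  -- The shift loses the deviation at `0` and gains the one at `N`, which is zero.
  have htel : ∑ i ∈ Finset.range N, quadNorm D.pertWeight (D.inputDev x m (i + 1))
      + quadNorm D.pertWeight (D.inputDev x m 0) = D.devCost x m := by
    rw [← Finset.sum_range_succ' (fun i => quadNorm D.pertWeight (D.inputDev x m i)),
      Finset.sum_range_succ, D.inputDev_of_le x m le_rfl, devCost]
    simp [quadNorm]
  have h0 : D.inputDev x m 0
      = D.control mstar x₀ ε₀ w k - (D.K *ᵥ (x - D.xr) + D.ur) := by
    rw [inputDev, extInput, dif_pos (NeZero.pos N)]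
    rfl
  rw [← h0, ← htel]
  linarith

/-- The squared deviations of the MPC law from the LQ-optimal law are summable, with a bound that
is uniform over the disturbance realisations. -/
lemma exists_sum_sqNorm_le (hW : D.W.PosSemidef)
    (hQ : D.Q.PosSemidef) (hR : D.R.PosDef) (hP : D.P.PosSemidef)
    (href : (1 - D.A) *ᵥ D.xr = D.B *ᵥ D.ur) (hstable : IsStrictlyStable D.Phi)
    (hLyap : D.P = D.Phiᵀ * D.P * D.Phi + D.Kᵀ * D.R * D.K + D.Q)
    (hK : IsLQOptimalGain D.A D.B D.Q D.R D.xr D.ur D.K) (hmstar : D.IsSolutionMap mstar)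
    (x₀ : Fin nx → ℝ) (ε₀ : ℝ) :
    ∃ b : ℝ, ∀ (w : ℕ → Fin nx → ℝ) (n : ℕ),
      ∑ k ∈ Finset.range n, sqNorm (D.control mstar x₀ ε₀ w k
        - (D.K *ᵥ (D.state mstar x₀ ε₀ w k - D.xr) + D.ur)) ≤ b := by
  have hS := D.pertWeight_posDef hR hP
  obtain ⟨c, hc, hle⟩ := exists_sqNorm_le_mul_quadNorm hS
  refine ⟨c * D.devCost x₀ (mstar x₀ ε₀), fun w n => ?_⟩
  have hV : D.devCost (D.state mstar x₀ ε₀ w n)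
        (mstar (D.state mstar x₀ ε₀ w n) (D.level mstar x₀ ε₀ w n))
      + ∑ k ∈ Finset.range n, quadNorm D.pertWeight (D.control mstar x₀ ε₀ w k
        - (D.K *ᵥ (D.state mstar x₀ ε₀ w k - D.xr) + D.ur))
      ≤ D.devCost x₀ (mstar x₀ ε₀) := by
    induction n with
    | zero => simp [state, level, closedLoop]
    | succ n ih =>
      have h := D.devCost_closedLoop_succ_le (x₀ := x₀) (ε₀ := ε₀) hW hQ hR.posSemidef hP href
        hstable hLyap hK hmstar w n
      rw [Finset.sum_range_succ]
      linarith
  calc _ ≤ ∑ k ∈ Finset.range n, c * quadNorm D.pertWeight (D.control mstar x₀ ε₀ w k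
        - (D.K *ᵥ (D.state mstar x₀ ε₀ w k - D.xr) + D.ur)) :=
        Finset.sum_le_sum fun _ _ => hle _
    _ ≤ _ := by
        rw [← Finset.mul_sum]
        refine mul_le_mul_of_nonneg_left ?_ hc
        linarith [D.devCost_nonneg hS.posSemidef (D.state mstar x₀ ε₀ w n)
          (mstar (D.state mstar x₀ ε₀ w n) (D.level mstar x₀ ε₀ w n))]

end ClosedLoop

end MPCData

/-! ### From bounded sums to convergence -/

lemma tendsto_zero_of_sqNorm {n : ℕ} {v : ℕ → Fin n → ℝ}
    (h : Tendsto (fun k => sqNorm (v k)) atTop (𝓝 0)) : Tendsto v atTop (𝓝 0) := by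
  rw [tendsto_pi_nhds]
  intro i
  have hsq : Tendsto (fun k => v k i * v k i) atTop (𝓝 0) :=
    squeeze_zero (fun k => mul_self_nonneg _) (fun k =>
      Finset.single_le_sum (f := fun i => v k i * v k i) (fun i _ => mul_self_nonneg (v k i))
        (Finset.mem_univ i)) h
  have habs := hsq.sqrt
  simp only [Real.sqrt_mul_self_eq_abs, Real.sqrt_zero] at habs
  exact (tendsto_zero_iff_abs_tendsto_zero _).mpr habs

/-- Nonnegative functions whose partial sums are uniformly bounded have integrals tending to `0`. -/
lemma tendsto_lintegral_ofReal_of_sum_le {Ω : Type*} [MeasurableSpace Ω]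
    (μ : MeasureTheory.Measure Ω) [MeasureTheory.IsFiniteMeasure μ] {f : ℕ → Ω → ℝ}
    (hf : ∀ k ω, 0 ≤ f k ω) {b : ℝ} (hb : ∀ ω n, ∑ k ∈ Finset.range n, f k ω ≤ b) :
    Tendsto (fun k => ∫⁻ ω, ENNReal.ofReal (f k ω) ∂μ) atTop (𝓝 0) := by
  -- Only superadditivity of the lower integral is used; it holds for arbitrary functions, so the `f
  -- k` need not be measurable.
  have hsuper : ∀ n, ∑ k ∈ Finset.range n, ∫⁻ ω, ENNReal.ofReal (f k ω) ∂μ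
      ≤ ∫⁻ ω, ENNReal.ofReal (∑ k ∈ Finset.range n, f k ω) ∂μ := by
    intro n
    induction n with
    | zero => simp
    | succ n ih =>
      rw [Finset.sum_range_succ]
      refine (add_le_add_left ih _).trans ((MeasureTheory.le_lintegral_add _ _).trans ?_)
      refine MeasureTheory.lintegral_mono fun ω => ?_
      rw [Finset.sum_range_succ, ENNReal.ofReal_add (Finset.sum_nonneg fun k _ => hf k ω) (hf n ω)]
  have hbound : ∑' k, ∫⁻ ω, ENNReal.ofReal (f k ω) ∂μ ≤ ENNReal.ofReal b * μ Set.univ := by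
    refine ENNReal.tsum_le_of_sum_range_le fun n => (hsuper n).trans ?_
    rw [← MeasureTheory.lintegral_const]
    exact MeasureTheory.lintegral_mono fun ω => ENNReal.ofReal_le_ofReal (hb ω n)
  exact ENNReal.tendsto_atTop_zero_of_tsum_ne_top
    (ne_top_of_le_ne_top (ENNReal.mul_ne_top ENNReal.ofReal_ne_top
      (MeasureTheory.measure_ne_top μ _)) hbound)

end ChanceMPC

theorem mainTheorem6 {nx nu nc N : ℕ} [NeZero N] (D : ChanceMPC.MPCData nx nu nc N)
    {Ω : Type*} [MeasurableSpace Ω] (μ : MeasureTheory.Measure Ω)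
    [MeasureTheory.IsProbabilityMeasure μ] (w : ℕ → Ω → Fin nx → ℝ)
    (hw : ChanceMPC.IsDisturbance μ D.W w)
    (hQ : D.Q.PosSemidef) (hR : D.R.PosDef)
    (ht : 0 < D.t) (hγ0 : 0 < D.γ) (hγ1 : D.γ < 1)
    (href : Matrix.mulVec (1 - D.A) D.xr = Matrix.mulVec D.B D.ur)
    (hCref : ChanceMPC.sqNorm (Matrix.mulVec D.C D.xr) < D.t ^ 2)
    (hctrl : ChanceMPC.IsControllable D.A D.B)
    (hobs : ChanceMPC.IsObservable D.A (CFC.sqrt D.Q))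
    (hstable : ChanceMPC.IsStrictlyStable D.Phi)
    (hP : D.P.PosDef)
    (hLyap : D.P = D.Phi.transpose * D.P * D.Phi + D.K.transpose * D.R * D.K + D.Q)
    (hK : ChanceMPC.IsLQOptimalGain D.A D.B D.Q D.R D.xr D.ur D.K)
    (mstar : (Fin nx → ℝ) → ℝ → Fin N → Fin nu → ℝ)
    (hmstar : D.IsSolutionMap mstar)
    (hmeas : Measurable (fun p : (Fin nx → ℝ) × ℝ => mstar p.1 p.2))
    (x₀ : Fin nx → ℝ) (ε₀ : ℝ) (hinit : ∃ m, D.Feasible x₀ ε₀ m) :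
    (∀ (ω : Ω) (k : ℕ),
      ∃ m, D.Feasible (D.state mstar x₀ ε₀ (fun j => w j ω) k)
        (D.level mstar x₀ ε₀ (fun j => w j ω) k) m) ∧
    (∀ ω : Ω, Filter.Tendsto
      (fun k => D.control mstar x₀ ε₀ (fun j => w j ω) k
        - (Matrix.mulVec D.K (D.state mstar x₀ ε₀ (fun j => w j ω) k - D.xr) + D.ur))
      Filter.atTop (nhds 0)) ∧
    Filter.Tendsto
      (fun k => ∫⁻ ω, ENNReal.ofReal (ChanceMPC.sqNorm
        (D.control mstar x₀ ε₀ (fun j => w j ω) k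
          - (Matrix.mulVec D.K (D.state mstar x₀ ε₀ (fun j => w j ω) k - D.xr) + D.ur))) ∂μ)
      Filter.atTop (nhds 0) := by
  have hW := hw.posSemidef
  obtain ⟨b, hb⟩ := D.exists_sum_sqNorm_le hW hQ hR hP.posSemidef href hstable hLyap hK hmstar x₀ ε₀
  refine ⟨fun ω k => D.feasible_closedLoop hW href hinit _ k, fun ω => ?_, ?_⟩
  · exact ChanceMPC.tendsto_zero_of_sqNorm (summable_of_sum_range_le
      (fun _ => ChanceMPC.sqNorm_nonneg _) (hb fun j => w j ω)).tendsto_atTop_zero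
  · exact ChanceMPC.tendsto_lintegral_ofReal_of_sum_le μ
      (fun _ _ => ChanceMPC.sqNorm_nonneg _) fun ω => hb fun j => w j ω
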